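/- Let $\ell>0$ and let $n\ge 1$ be an integer. Let $Z=\{(x_1,x_2,x_3)\in\mathbb{R}^3: x_1^2+x_2^2\le 1\}$ be the solid unit cylinder, let $T_{\ell\pi e_3}$ be the translation by $\ell\pi e_3$, and let $\varpi\colon\mathbb{R}^3\to\mathbb{R}^3/\langle T_{\ell\pi e_3}\rangle$ be the quotient map, so that $\tilde Z_\ell=\varpi(Z)=Z/\langle T_{\ell\pi e_3}\rangle$ is a flat solid torus. Let $X=\{x\in\mathbb{R}^3: x_1\sin x_3=x_2\cos x_3\}$ be the helicoid, and let $\tilde X_n=\varpi\bigl(Z\cap\tfrac{\ell}{n}X\bigr)\subset\tilde Z_\ell$. Let $G_n$ be the group of isometries of $\mathbb{R}^3$ generated by the rotation by $\pi$ around the $x_1$-axis and the translation by $(\ell\pi/n)e_3$; the dihedral group $\mathbb{D}_n$ of order $2n$ acts on $\tilde Z_\ell$ as $G_n/\langle T_{\ell\pi e_3}\rangle$. Then the following hold. 1. $\varpi^{-1}(\tilde X_n)=Z\cap\tfrac{\ell}{n}X$, and $\tilde X_n$ is $\mathbb{D}_n$-equivariant. 2. The map $(t,v)\mapsto\varpi\bigl(v\cos(n\pi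 t),\,v\sin(n\pi t),\,\ell\pi t\bigr)$ on $\mathbb{R}\times[-1,1]$ induces a smooth, proper embedding of the quotient of $\mathbb{R}\times[-1,1]$ by $(t,v)\sim(t+1,(-1)^n v)$ onto $\tilde X_n$, and $\tilde X_n$ is a free boundary minimal surface in $\tilde Z_\ell$ (its mean curvature vanishes and it meets $\partial\tilde Z_\ell$ orthogonally along its boundary). In particular, $\tilde X_n$ is an annulus if $n$ is even and a Möbius band if $n$ is odd. 3. The Morse index of $\tilde X_n$ is at least $n$. Here the Morse index of $\Sigma=\tilde X_n$ is the largest dimension of a linear space of smooth sections of the normal bundle of $\Sigma$ on which the index form $$Q(fN,fN)=\int_\Sigma\bigl(|\nabla f|^2-|A|^2f^2\bigr)-\int_{\partial\Sigma}\mathrm{II}(N,N)\,f^2$$ is negative definite, where $N$ is a local unit normal of $\Sigma$, $A$ is the second fundamental form of $\Sigma$, and $\mathrm{II}(N,N)=\langle D_N\nu,N\rangle$ is the second fundamental form of $\partial\tilde Z_\ell$ with respect to its outward unit normal $\nu$ (nonnegative, since $Z$ is convex). Thus the index grows without bound as $n\to\infty$, whereas the topology of $\tilde X_n$ depends only on the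 parity of $n$. -/

import Mathlib

open Set MeasureTheory Topology
open scoped Matrix Pointwise ContDiff

noncomputable section

namespace HelicoidIndex

/-- Euclidean three-space. -/
abbrev E3 : Type := EuclideanSpace ℝ (Fin 3)

/-! ### The solid cylinder, its quotient, and the helicoid -/

/-- The solid unit cylinder `Z = 𝔹² × ℝ`. -/
def solidCylinder : Set E3 := {p | p 0 ^ 2 + p 1 ^ 2 ≤ 1}

/-- The boundary `∂Z` of the solid cylinder. -/
def cylinderBoundary : Set E3 := {p | p 0 ^ 2 + p 1 ^ 2 = 1}

/-- A smooth vector field whose restriction to `∂Z` is the outward unit normal of `Z`. -/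
def outwardNormal (p : E3) : E3 := !₂[p 0, p 1, 0]

/-- The vertical vector `a e₃`. -/
def vertical (a : ℝ) : E3 := !₂[0, 0, a]

/-- The group of translations generated by the translation by `ℓ π e₃`. -/
def periodGroup (ℓ : ℝ) : AddSubgroup E3 :=
  AddSubgroup.zmultiples (vertical (ℓ * Real.pi))

/-- The covering map from `ℝ³` to the flat manifold `ℝ³ / ⟨T_{ℓ π e₃}⟩`. -/
def proj (ℓ : ℝ) (p : E3) : E3 ⧸ periodGroup ℓ := QuotientAddGroup.mk p

/-- The solid torus `Z / ⟨T_{ℓ π e₃}⟩`. -/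
def solidTorus (ℓ : ℝ) : Set (E3 ⧸ periodGroup ℓ) := proj ℓ '' solidCylinder

/-- The helicoid `x₁ tan x₃ = x₂`, which also contains the horizontal lines at the heights where
the tangent is infinite; hence the equation is written as `x₁ sin x₃ = x₂ cos x₃`. -/
def helicoid : Set E3 := {p | p 0 * Real.sin (p 2) = p 1 * Real.cos (p 2)}

/-- The helicoid piece `Z ∩ (ℓ/n) X`. -/
def helicoidPiece (ℓ : ℝ) (n : ℕ) : Set E3 := solidCylinder ∩ ((ℓ / n) • helicoid)

/-- The image of the helicoid piece in the solid torus. -/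
def helicoidQuotient (ℓ : ℝ) (n : ℕ) : Set (E3 ⧸ periodGroup ℓ) :=
  proj ℓ '' helicoidPiece ℓ n

/-! ### The symmetry group -/

/-- Rotation by angle `π` around the `x₁`-axis, as a map. -/
def rotFun (p : E3) : E3 := !₂[p 0, -p 1, -p 2]

theorem rotFun_rotFun (p : E3) : rotFun (rotFun p) = p := by
  ext i
  fin_cases i <;> simp [rotFun]

theorem isometry_rotFun : Isometry rotFun := by
  refine Isometry.of_dist_eq fun p q => ?_
  simp only [EuclideanSpace.dist_eq, Fin.sum_univ_three, Real.dist_eq, sq_abs, rotFun]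
  congr 1
  simp
  ring

/-- Rotation by angle `π` around the `x₁`-axis. -/
def rotation : E3 ≃ᵢ E3 := IsometryEquiv.mk' rotFun rotFun rotFun_rotFun isometry_rotFun

/-- The group `G_n` of isometries generated by the rotation by `π` around the `x₁`-axis and the
translation by `(ℓ π / n) e₃`. The dihedral group of order `2 n` acts on the quotient as
`G_n / ⟨T_{ℓ π e₃}⟩`. -/
def symmetryGroup (ℓ : ℝ) (n : ℕ) : Subgroup (E3 ≃ᵢ E3) :=
  Subgroup.closure {rotation, IsometryEquiv.addRight (vertical (ℓ * Real.pi / n))}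

/-- Equivariance of a subset of the quotient under the dihedral group of order `2 n`. -/
def IsDihedralEquivariant (ℓ : ℝ) (n : ℕ) (S : Set (E3 ⧸ periodGroup ℓ)) : Prop :=
  ∀ g ∈ symmetryGroup ℓ n, ∀ p : E3, proj ℓ (g p) ∈ S ↔ proj ℓ p ∈ S

/-! ### Annuli and Möbius bands -/

/-- The strip `ℝ × [-1, 1]`, the universal cover of the annulus and of the Möbius band. -/
def strip : Set (ℝ × ℝ) := {p | p.2 ∈ Icc (-1 : ℝ) 1}

/-- The fundamental domain `[0, 1] × [-1, 1]`. -/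
def fundamentalDomain : Set (ℝ × ℝ) := Icc (0 : ℝ) 1 ×ˢ Icc (-1 : ℝ) 1

/-- The power `(t, v) ↦ (t + k, ε ^ k v)` of the generating deck transformation
`(t, v) ↦ (t + 1, ε v)`, for a sign `ε`. -/
def deck (ε : ℤˣ) (k : ℤ) (p : ℝ × ℝ) : ℝ × ℝ := (p.1 + k, (((ε ^ k : ℤˣ) : ℤ) : ℝ) * p.2)

theorem deck_zero (ε : ℤˣ) (p : ℝ × ℝ) : deck ε 0 p = p := by simp [deck]

theorem deck_add (ε : ℤˣ) (k l : ℤ) (p : ℝ × ℝ) : deck ε (k + l) p = deck ε l (deck ε k p) := by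
  simp only [deck, zpow_add, Units.val_mul, Int.cast_add, Int.cast_mul, Prod.mk.injEq]
  constructor <;> ring

/-- Two points of the strip are equivalent if a deck transformation maps one to the other. -/
def bandSetoid (ε : ℤˣ) : Setoid strip where
  r p q := ∃ k : ℤ, (q : ℝ × ℝ) = deck ε k p
  iseqv :=
    { refl := fun p => ⟨0, (deck_zero ε p).symm⟩
      symm := by
        rintro p q ⟨k, hk⟩
        refine ⟨-k, ?_⟩
        rw [hk, ← deck_add, add_neg_cancel, deck_zero]
      trans := by
        rintro p q r ⟨k, hk⟩ ⟨l, hl⟩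
        exact ⟨k + l, by rw [hl, hk, deck_add]⟩ }

/-- The quotient of `ℝ × [-1, 1]` by `(t, v) ∼ (t + 1, ε v)`, with the quotient topology:
an annulus for `ε = 1` and a Möbius band for `ε = -1`. -/
abbrev Band (ε : ℤˣ) : Type := Quotient (bandSetoid ε)

/-! ### Geometry of parametrised surfaces in Euclidean space -/

/-- The two coordinate directions of the parameter plane. -/
def coordDir : Fin 2 → ℝ × ℝ := ![(1, 0), (0, 1)]

/-- Partial derivative in the `i`-th coordinate direction. -/
def pderiv {F : Type*} [NormedAddCommGroup F] [NormedSpace ℝ F] (i : Fin 2) (φ : ℝ × ℝ → F)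
    (p : ℝ × ℝ) : F := fderiv ℝ φ p (coordDir i)

/-- The first fundamental form `g`. -/
def firstForm (φ : ℝ × ℝ → E3) (p : ℝ × ℝ) : Matrix (Fin 2) (Fin 2) ℝ :=
  Matrix.of fun i j => inner ℝ (pderiv i φ p) (pderiv j φ p)

/-- The density `√(det g)` of the area measure. -/
def areaDensity (φ : ℝ × ℝ → E3) (p : ℝ × ℝ) : ℝ := Real.sqrt (firstForm φ p).det

/-- The cross product of the two coordinate tangent vectors. -/
def normalVector (φ : ℝ × ℝ → E3) (p : ℝ × ℝ) : E3 :=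
  WithLp.toLp 2 ((pderiv 0 φ p).ofLp ⨯₃ (pderiv 1 φ p).ofLp)

/-- The unit normal `N` along an immersed parametrised surface. -/
def unitNormal (φ : ℝ × ℝ → E3) (p : ℝ × ℝ) : E3 := ‖normalVector φ p‖⁻¹ • normalVector φ p

/-- The second fundamental form `A` with respect to the unit normal `N`. -/
def secondForm (φ : ℝ × ℝ → E3) (p : ℝ × ℝ) : Matrix (Fin 2) (Fin 2) ℝ :=
  Matrix.of fun i j => inner ℝ (pderiv i (pderiv j φ) p) (unitNormal φ p)

/-- The mean curvature, that is, the trace of `A` with respect to `g`. -/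
def meanCurvature (φ : ℝ × ℝ → E3) (p : ℝ × ℝ) : ℝ :=
  ((firstForm φ p)⁻¹ * secondForm φ p).trace

/-- The squared norm `|A|²` of the second fundamental form with respect to `g`. -/
def secondFormNormSq (φ : ℝ × ℝ → E3) (p : ℝ × ℝ) : ℝ :=
  (((firstForm φ p)⁻¹ * secondForm φ p) * ((firstForm φ p)⁻¹ * secondForm φ p)).trace

/-- The squared norm `|∇f|²` of the gradient of a function on the surface with respect to `g`. -/
def gradNormSq (φ : ℝ × ℝ → E3) (f : ℝ × ℝ → ℝ) (p : ℝ × ℝ) : ℝ :=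
  ∑ i, ∑ j, (firstForm φ p)⁻¹ i j * pderiv i f p * pderiv j f p

/-- The second fundamental form of `∂Z`, evaluated at `(N, N)`, with the sign that makes it
nonnegative for the convex domain `Z`: it is `⟨D_N ν, N⟩` for the outward unit normal `ν`. -/
def boundaryForm (φ : ℝ × ℝ → E3) (p : ℝ × ℝ) : ℝ :=
  inner ℝ (fderiv ℝ outwardNormal (φ p) (unitNormal φ p)) (unitNormal φ p)

/-! ### Free boundary minimal bands in the solid torus and their Morse index -/

/-- The map `φ`, restricted to the strip, induces a smooth, proper embedding of the annulus
(`ε = 1`) or Möbius band (`ε = -1`) onto the subset `S` of the solid torus `Z / ⟨T_{ℓ π e₃}⟩`,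
and `S` is a free boundary minimal surface, that is, its mean curvature vanishes and it meets
the boundary of the solid torus orthogonally along its own boundary. -/
structure IsFreeBoundaryMinimalBand (ℓ : ℝ) (ε : ℤˣ) (φ : ℝ × ℝ → E3)
    (S : Set (E3 ⧸ periodGroup ℓ)) : Prop where
  smooth : ContDiff ℝ ∞ φ
  immersion : ∀ p ∈ strip, Function.Injective (fderiv ℝ φ p)
  embedding : ∃ Φ : Band ε → E3 ⧸ periodGroup ℓ, IsEmbedding Φ ∧
    (∀ p : strip, Φ (Quotient.mk (bandSetoid ε) p) = proj ℓ (φ p)) ∧ range Φ = S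
  mem_cylinder : ∀ p ∈ strip, φ p ∈ solidCylinder
  proper : ∀ p ∈ strip, φ p ∈ cylinderBoundary ↔ |p.2| = 1
  minimal : ∀ p ∈ strip, meanCurvature φ p = 0
  orthogonal : ∀ p ∈ strip, |p.2| = 1 → inner ℝ (unitNormal φ p) (outwardNormal (φ p)) = 0

/-- The smooth functions `f` on the strip (restrictions of smooth functions on the plane) for
which the normal vector field `f N` is invariant under deck transformations. These represent
exactly the smooth sections `f N` of the normal bundle of the quotient surface, which need not be
two-sided. -/
def normalSections (ε : ℤˣ) (φ : ℝ × ℝ → E3) : Submodule ℝ (ℝ × ℝ → ℝ) where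
  carrier := {f | ContDiff ℝ ∞ f ∧
    ∀ p ∈ strip, f (deck ε 1 p) • unitNormal φ (deck ε 1 p) = f p • unitNormal φ p}
  add_mem' := by
    rintro f g ⟨hf, hf2⟩ ⟨hg, hg2⟩
    refine ⟨hf.add hg, fun p hp => ?_⟩
    simp only [Pi.add_apply, add_smul, hf2 p hp, hg2 p hp]
  zero_mem' := ⟨contDiff_const, fun p _ => by simp⟩
  smul_mem' := by
    rintro c f ⟨hf, hf2⟩
    refine ⟨contDiff_const.smul hf, fun p hp => ?_⟩
    simp only [Pi.smul_apply, smul_assoc, hf2 p hp]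

/-- The index form (second variation of area) of a free boundary minimal band in the flat
manifold `Z / ⟨T_{ℓ π e₃}⟩`, evaluated on the normal section `f N`:
`Q(f, f) = ∫_Σ (|∇f|² - |A|² f²) - ∫_{∂Σ} II(N, N) f²`. -/
def indexForm (φ : ℝ × ℝ → E3) (f : ℝ × ℝ → ℝ) : ℝ :=
  (∫ p in fundamentalDomain,
      (gradNormSq φ f p - secondFormNormSq φ p * f p ^ 2) * areaDensity φ p)
    - ((∫ t in (0 : ℝ)..1, boundaryForm φ (t, 1) * f (t, 1) ^ 2 * ‖pderiv 0 φ (t, 1)‖)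
      + ∫ t in (0 : ℝ)..1, boundaryForm φ (t, -1) * f (t, -1) ^ 2 * ‖pderiv 0 φ (t, -1)‖)

/-- The Morse index: the largest dimension of a space of smooth normal sections on which the index
form is negative definite. A function that vanishes on the strip has index form zero, so such
a space is faithfully represented by its restrictions to the strip. -/
def morseIndex (ε : ℤˣ) (φ : ℝ × ℝ → E3) : ℕ∞ :=
  sSup {k : ℕ∞ | ∃ V : Submodule ℝ (ℝ × ℝ → ℝ), V ≤ normalSections ε φ ∧
    FiniteDimensional ℝ V ∧ (Module.finrank ℝ V : ℕ∞) = k ∧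
    ∀ f ∈ V, f ≠ 0 → indexForm φ f < 0}

/-- The ruled parametrisation of `Z ∩ (ℓ/n) X` over the strip,
`(t, v) ↦ (v cos (n π t), v sin (n π t), ℓ π t)`. -/
def helicoidParam (ℓ : ℝ) (n : ℕ) (p : ℝ × ℝ) : E3 :=
  !₂[p.2 * Real.cos (n * Real.pi * p.1), p.2 * Real.sin (n * Real.pi * p.1), ℓ * Real.pi * p.1]

end HelicoidIndex

end

open HelicoidIndex

namespace HelicoidIndex

/-! ### The helicoid piece and its symmetries -/

/-! The geometric claims follow from the ruled parametrisation. It is injective on the plane and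
intertwines the deck transformations with the vertical translations, so it descends to an injective
continuous map from a compact band to a Hausdorff space. Its metric is `w² dt² + dv²` with `w =
stretch`, its second fundamental form is off-diagonal, and the rulings are radial, which gives
minimality and the free boundary condition.

For the index, the test sections are `f = T(t) / w(v)`. When `T` is `cos (n π t)` or `sin (n π t)`,
these are, up to a constant, the normal components of horizontal translations, hence Jacobi
functions. Consequently the interior part of the index form at frequency `n` collapses to a negative
boundary term (`integral_jacobi`), and the convexity of the cylinder lowers the form further. A
smaller Dirichlet energy of `T` only helps, so `∫ T'² ≤ (n π)² ∫ T²` already suffices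
(`indexForm_neg_of_integral_sq_le`).

The section `f N` descends to the quotient when the frequencies in `T` have the parity of `n`. The
frequencies `-n, -n + 2, …, n` are available, one mode each, and Parseval gives the energy bound on
their span. This yields index at least `n + 1`, one more than required. -/

theorem mem_helicoidPiece {ℓ : ℝ} (hℓ : 0 < ℓ) {n : ℕ} (hn : 1 ≤ n) {p : E3} :
    p ∈ helicoidPiece ℓ n ↔ p 0 ^ 2 + p 1 ^ 2 ≤ 1 ∧
      p 0 * Real.sin (n / ℓ * p 2) = p 1 * Real.cos (n / ℓ * p 2) := by
  have hn' : (0 : ℝ) < n := by exact_mod_cast hn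
  have hc : ℓ / n ≠ 0 := by positivity
  rw [helicoidPiece, mem_inter_iff, mem_smul_set_iff_inv_smul_mem₀ hc]
  simp only [solidCylinder, helicoid, mem_ofPred_eq, PiLp.smul_apply, smul_eq_mul, inv_div, mul_assoc]
  have : (n / ℓ : ℝ) ≠ 0 := by positivity
  rw [mul_right_inj' this]

theorem sin_add_zmul_pi (x : ℝ) (k : ℤ) :
    Real.sin (x + k * Real.pi) = (((-1 : ℤˣ) ^ k : ℤˣ) : ℤ) * Real.sin x := by
  rw [Real.sin_add_int_mul_pi]
  rcases Int.even_or_odd k with h | h <;> simp [h.neg_one_zpow]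

theorem cos_add_zmul_pi (x : ℝ) (k : ℤ) :
    Real.cos (x + k * Real.pi) = (((-1 : ℤˣ) ^ k : ℤˣ) : ℤ) * Real.cos x := by
  rw [Real.cos_add_int_mul_pi]
  rcases Int.even_or_odd k with h | h <;> simp [h.neg_one_zpow]

theorem negOne_pow_zpow (n : ℕ) (k : ℤ) : ((-1 : ℤˣ) ^ n) ^ k = (-1) ^ ((n : ℤ) * k) := by
  rw [zpow_mul, zpow_natCast]

theorem unit_cast_mul_self (u : ℤˣ) : ((u : ℤ) : ℝ) * ((u : ℤ) : ℝ) = 1 := by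
  rcases Int.units_eq_one_or u with rfl | rfl <;> simp

theorem mul_eq_mul_unit_cancel (u : ℤˣ) (x y : ℝ) :
    ((u : ℤ) : ℝ) * x = ((u : ℤ) : ℝ) * y ↔ x = y := by
  have h := unit_cast_mul_self u
  have h0 : ((u : ℤ) : ℝ) ≠ 0 := fun h0 => by simp [h0] at h
  exact mul_right_inj' h0

/-- The helicoid piece is invariant under translations by multiples of `ℓ π / n`. -/
theorem add_vertical_mem_helicoidPiece {ℓ : ℝ} (hℓ : 0 < ℓ) {n : ℕ} (hn : 1 ≤ n) (k : ℤ)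
    (p : E3) :
    p + vertical (k * (ℓ * Real.pi / n)) ∈ helicoidPiece ℓ n ↔ p ∈ helicoidPiece ℓ n := by
  have hn' : (n : ℝ) ≠ 0 := by positivity
  have e : (n / ℓ : ℝ) * (p 2 + k * (ℓ * Real.pi / n)) = n / ℓ * p 2 + k * Real.pi := by
    field_simp
  rw [mem_helicoidPiece hℓ hn, mem_helicoidPiece hℓ hn]
  simp only [vertical, PiLp.add_apply, Matrix.cons_val, add_zero, e,
    sin_add_zmul_pi, cos_add_zmul_pi]
  -- Shifting the angle by `k π` multiplies both sides of the equation by the same sign.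
  rw [mul_left_comm, mul_left_comm (p 1), mul_eq_mul_unit_cancel]

theorem rotation_mem_helicoidPiece {ℓ : ℝ} (hℓ : 0 < ℓ) {n : ℕ} (hn : 1 ≤ n) (p : E3) :
    rotation p ∈ helicoidPiece ℓ n ↔ p ∈ helicoidPiece ℓ n := by
  rw [mem_helicoidPiece hℓ hn, mem_helicoidPiece hℓ hn]
  have : rotation p = rotFun p := rfl
  simp [this, rotFun]

theorem symmetryGroup_mem_helicoidPiece {ℓ : ℝ} (hℓ : 0 < ℓ) {n : ℕ} (hn : 1 ≤ n)
    {g : E3 ≃ᵢ E3} (hg : g ∈ symmetryGroup ℓ n) (p : E3) :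
    g p ∈ helicoidPiece ℓ n ↔ p ∈ helicoidPiece ℓ n := by
  revert p
  induction hg using Subgroup.closure_induction with
  | mem g hg =>
    rcases hg with rfl | rfl
    · exact rotation_mem_helicoidPiece hℓ hn
    · intro p
      simpa using add_vertical_mem_helicoidPiece hℓ hn 1 p
  | one => intro p; rfl
  | mul g h _ _ hg hh => intro p; exact (hg (h p)).trans (hh p)
  | inv g _ hg =>
    intro p
    rw [← hg (g⁻¹ p), ← IsometryEquiv.mul_apply, mul_inv_cancel, IsometryEquiv.coe_one, id]

theorem zsmul_vertical (k : ℤ) (a : ℝ) : k • vertical a = vertical (k * a) := by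
  ext i
  fin_cases i <;> simp [vertical]

theorem proj_eq_proj {ℓ : ℝ} {p q : E3} :
    proj ℓ p = proj ℓ q ↔ ∃ k : ℤ, q = p + vertical (k * (ℓ * Real.pi)) := by
  rw [proj, proj, QuotientAddGroup.eq, periodGroup, AddSubgroup.mem_zmultiples_iff]
  simp only [zsmul_vertical]
  constructor <;> rintro ⟨k, hk⟩ <;> refine ⟨k, ?_⟩
  · rw [hk]; abel
  · rw [hk]; abel

theorem preimage_helicoidQuotient {ℓ : ℝ} (hℓ : 0 < ℓ) {n : ℕ} (hn : 1 ≤ n) :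
    proj ℓ ⁻¹' helicoidQuotient ℓ n = helicoidPiece ℓ n := by
  refine Subset.antisymm ?_ (subset_preimage_image _ _)
  rintro p ⟨q, hq, hqp⟩
  obtain ⟨k, rfl⟩ := proj_eq_proj.1 hqp
  have hn' : (n : ℝ) ≠ 0 := by positivity
  -- One period of the quotient consists of `n` steps of the finer translational symmetry.
  have e : (k : ℝ) * (ℓ * Real.pi) = ((k * n : ℤ) : ℝ) * (ℓ * Real.pi / n) := by
    push_cast
    field_simp
  rwa [e, add_vertical_mem_helicoidPiece hℓ hn]

theorem isDihedralEquivariant_helicoidQuotient {ℓ : ℝ} (hℓ : 0 < ℓ) {n : ℕ} (hn : 1 ≤ n) :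
    IsDihedralEquivariant ℓ n (helicoidQuotient ℓ n) := by
  intro g hg p
  have h : ∀ q, proj ℓ q ∈ helicoidQuotient ℓ n ↔ q ∈ helicoidPiece ℓ n := fun q => by
    rw [← mem_preimage, preimage_helicoidQuotient hℓ hn]
  rw [h, h]
  exact symmetryGroup_mem_helicoidPiece hℓ hn hg p

/-! ### The parametrisation -/

@[simp] theorem helicoidParam_zero (ℓ : ℝ) (n : ℕ) (p : ℝ × ℝ) :
    helicoidParam ℓ n p 0 = p.2 * Real.cos (n * Real.pi * p.1) := rfl

@[simp] theorem helicoidParam_one (ℓ : ℝ) (n : ℕ) (p : ℝ × ℝ) :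
    helicoidParam ℓ n p 1 = p.2 * Real.sin (n * Real.pi * p.1) := rfl

@[simp] theorem helicoidParam_two (ℓ : ℝ) (n : ℕ) (p : ℝ × ℝ) :
    helicoidParam ℓ n p 2 = ℓ * Real.pi * p.1 := rfl

theorem helicoidParam_sq_add_sq (ℓ : ℝ) (n : ℕ) (p : ℝ × ℝ) :
    helicoidParam ℓ n p 0 ^ 2 + helicoidParam ℓ n p 1 ^ 2 = p.2 ^ 2 := by
  simp only [helicoidParam_zero, helicoidParam_one]
  linear_combination p.2 ^ 2 * Real.sin_sq_add_cos_sq (n * Real.pi * p.1)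

theorem contDiff_helicoidParam (ℓ : ℝ) (n : ℕ) : ContDiff ℝ ∞ (helicoidParam ℓ n) := by
  rw [contDiff_euclidean]
  intro i
  fin_cases i
  · change ContDiff ℝ ∞ fun p : ℝ × ℝ => p.2 * Real.cos (n * Real.pi * p.1)
    fun_prop
  · change ContDiff ℝ ∞ fun p : ℝ × ℝ => p.2 * Real.sin (n * Real.pi * p.1)
    fun_prop
  · change ContDiff ℝ ∞ fun p : ℝ × ℝ => ℓ * Real.pi * p.1
    fun_prop

theorem sq_le_one_of_mem_strip {p : ℝ × ℝ} (hp : p ∈ strip) : p.2 ^ 2 ≤ 1 := by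
  rw [sq_le_one_iff_abs_le_one]
  exact abs_le.2 hp

theorem image_helicoidParam {ℓ : ℝ} (hℓ : 0 < ℓ) {n : ℕ} (hn : 1 ≤ n) :
    helicoidParam ℓ n '' strip = helicoidPiece ℓ n := by
  have hpi := Real.pi_pos
  ext q
  rw [mem_helicoidPiece hℓ hn]
  constructor
  · rintro ⟨p, hp, rfl⟩
    refine ⟨by rw [helicoidParam_sq_add_sq]; exact sq_le_one_of_mem_strip hp, ?_⟩
    have e : (n / ℓ : ℝ) * (ℓ * Real.pi * p.1) = n * Real.pi * p.1 := by field_simp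
    simp only [helicoidParam_zero, helicoidParam_one, helicoidParam_two, e]
    ring
  · rintro ⟨h1, h2⟩
    set s := (n / ℓ : ℝ) * q 2 with hs
    have hcs := Real.sin_sq_add_cos_sq s
    have e : (n : ℝ) * Real.pi * (q 2 / (ℓ * Real.pi)) = s := by
      rw [hs]
      field_simp
    have e0 : (q 0 * Real.cos s + q 1 * Real.sin s) * Real.cos s = q 0 := by
      linear_combination q 0 * hcs - Real.sin s * h2
    have e1 : (q 0 * Real.cos s + q 1 * Real.sin s) * Real.sin s = q 1 := by
      linear_combination q 1 * hcs + Real.cos s * h2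
    -- The helicoid equation says that the horizontal part of `q` is parallel to the ruling
    -- direction `(cos s, sin s)`, so `v` is its component along that direction.
    refine ⟨(q 2 / (ℓ * Real.pi), q 0 * Real.cos s + q 1 * Real.sin s), ?_, ?_⟩
    · refine abs_le.1 ?_
      rw [← sq_le_one_iff_abs_le_one]
      refine le_trans (le_of_eq ?_) h1
      linear_combination (q 0 * Real.cos s + q 1 * Real.sin s) * Real.cos s * e0 + q 0 * e0
        + (q 0 * Real.cos s + q 1 * Real.sin s) * Real.sin s * e1 + q 1 * e1
        - (q 0 * Real.cos s + q 1 * Real.sin s) ^ 2 * hcs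
    · ext i
      fin_cases i
      · simp [e, e0]
      · simp [e, e1]
      · simp
        field_simp

/-- The angle grows by `n k π`, which reverses the ruling direction exactly when the deck
transformation reverses `v`; the two signs cancel in the horizontal coordinates. -/
theorem helicoidParam_deck (ℓ : ℝ) (n : ℕ) (k : ℤ) (p : ℝ × ℝ) :
    helicoidParam ℓ n (deck ((-1) ^ n) k p)
      = helicoidParam ℓ n p + vertical (k * (ℓ * Real.pi)) := by
  have h := unit_cast_mul_self (((-1 : ℤˣ) ^ n) ^ k)
  have e : (n : ℝ) * Real.pi * (p.1 + k) = n * Real.pi * p.1 + ((n * k : ℤ) : ℝ) * Real.pi := by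
    push_cast
    ring
  rw [negOne_pow_zpow] at h
  ext i
  fin_cases i
  · simp only [Fin.zero_eta, helicoidParam_zero, deck, e, cos_add_zmul_pi, negOne_pow_zpow,
      vertical, PiLp.add_apply, Matrix.cons_val, add_zero]
    linear_combination p.2 * Real.cos (n * Real.pi * p.1) * h
  · simp only [Fin.mk_one, helicoidParam_one, deck, e, sin_add_zmul_pi, negOne_pow_zpow,
      vertical, PiLp.add_apply, Matrix.cons_val, add_zero]
    linear_combination p.2 * Real.sin (n * Real.pi * p.1) * h
  · simp only [Fin.reduceFinMk, helicoidParam_two, deck,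
      vertical, PiLp.add_apply, Matrix.cons_val]
    ring

theorem helicoidParam_injective {ℓ : ℝ} (hℓ : 0 < ℓ) (n : ℕ) :
    Function.Injective (helicoidParam ℓ n) := by
  intro p q h
  have hpi := Real.pi_pos
  have h0 : p.2 * Real.cos (n * Real.pi * p.1) = q.2 * Real.cos (n * Real.pi * q.1) :=
    congrArg (fun x : E3 => x 0) h
  have h1 : p.2 * Real.sin (n * Real.pi * p.1) = q.2 * Real.sin (n * Real.pi * q.1) :=
    congrArg (fun x : E3 => x 1) h
  have h2 : ℓ * Real.pi * p.1 = ℓ * Real.pi * q.1 := congrArg (fun x : E3 => x 2) h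
  have e1 : p.1 = q.1 := mul_left_cancel₀ (by positivity) h2
  refine Prod.ext e1 ?_
  rw [e1] at h0 h1
  -- At equal heights the rulings coincide, and pairing with the ruling direction recovers `v`.
  linear_combination (q.2 - p.2) * Real.sin_sq_add_cos_sq (n * Real.pi * q.1)
    + Real.cos (n * Real.pi * q.1) * h0 + Real.sin (n * Real.pi * q.1) * h1

/-! ### The embedding of the band -/

theorem proj_helicoidParam_eq_iff {ℓ : ℝ} (hℓ : 0 < ℓ) (n : ℕ) (p q : ℝ × ℝ) :
    proj ℓ (helicoidParam ℓ n p) = proj ℓ (helicoidParam ℓ n q) ↔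
      ∃ k : ℤ, q = deck ((-1) ^ n) k p := by
  rw [proj_eq_proj]
  simp only [← helicoidParam_deck, (helicoidParam_injective hℓ n).eq_iff]

/-- The period group is discrete, hence closed. The Hausdorff property of the quotient makes
continuous injections from compact spaces into embeddings. -/
instance t3Space_quotient (ℓ : ℝ) : T3Space (E3 ⧸ periodGroup ℓ) := by
  have : DiscreteTopology (periodGroup ℓ) := NormedSpace.discreteTopology_zmultiples _
  have : IsClosed (periodGroup ℓ : Set E3) := AddSubgroup.isClosed_of_discrete
  infer_instance

theorem deck_mem_strip (ε : ℤˣ) (k : ℤ) {p : ℝ × ℝ} (hp : p ∈ strip) : deck ε k p ∈ strip := by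
  rcases Int.units_eq_one_or (ε ^ k) with h | h
  · simpa [strip, deck, h] using hp
  · simp only [strip, deck, h, mem_ofPred_eq, mem_Icc] at hp ⊢
    constructor <;> push_cast <;> linarith [hp.1, hp.2]

instance compactSpace_band (ε : ℤˣ) : CompactSpace (Band ε) := by
  let K : Set strip := Subtype.val ⁻¹' fundamentalDomain
  have hsub : fundamentalDomain ⊆ strip := fun p hp => hp.2
  have hK : IsCompact K := by
    refine Topology.IsInducing.subtypeVal.isCompact_preimage_iff ?_ |>.2
      (isCompact_Icc.prod isCompact_Icc)
    rw [Subtype.range_coe]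
    exact hsub
  refine ⟨?_⟩
  have himg : Quotient.mk (bandSetoid ε) '' K = univ := by
    refine eq_univ_of_forall fun x => ?_
    induction x using Quotient.inductionOn with
    | h p =>
      obtain ⟨p, hp⟩ := p
      -- Subtracting the integer part of `t` moves a point into the fundamental domain.
      refine ⟨⟨deck ε (-⌊p.1⌋) p, deck_mem_strip ε _ hp⟩, ?_, ?_⟩
      · refine ⟨?_, (deck_mem_strip ε _ hp)⟩
        have h1 := Int.floor_le p.1
        have h2 := Int.lt_floor_add_one p.1
        simp only [deck, mem_Icc]
        constructor <;> push_cast <;> linarith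
      · refine (Quotient.sound (s := bandSetoid ε) ?_).symm
        exact ⟨_, rfl⟩
  rw [← himg]
  exact hK.image continuous_quotient_mk'

theorem exists_embedding_helicoidQuotient {ℓ : ℝ} (hℓ : 0 < ℓ) {n : ℕ} (hn : 1 ≤ n) :
    ∃ Φ : Band ((-1) ^ n) → E3 ⧸ periodGroup ℓ, IsEmbedding Φ ∧
      (∀ p : strip, Φ (Quotient.mk (bandSetoid ((-1) ^ n)) p) = proj ℓ (helicoidParam ℓ n p)) ∧
      range Φ = helicoidQuotient ℓ n := by
  let F : strip → E3 ⧸ periodGroup ℓ := fun p => proj ℓ (helicoidParam ℓ n p)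
  have hF : Continuous F :=
    continuous_quotient_mk'.comp ((contDiff_helicoidParam ℓ n).continuous.comp
      continuous_subtype_val)
  have hsound : ∀ p q : strip, (bandSetoid ((-1) ^ n)).r p q → F p = F q := fun p q h =>
    (proj_helicoidParam_eq_iff hℓ n p q).2 h
  refine ⟨Quotient.lift F hsound, ?_, fun _ => rfl, ?_⟩
  · refine ((hF.quotient_lift hsound).isClosedEmbedding ?_).isEmbedding
    intro x y
    induction x, y using Quotient.inductionOn₂ with
    | h p q =>
      intro h
      exact Quotient.sound (s := bandSetoid ((-1) ^ n))
        ((proj_helicoidParam_eq_iff hℓ n p q).1 h)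
  · rw [show range (Quotient.lift F hsound) = range F from
      Set.range_quot_lift hsound, helicoidQuotient, ← image_helicoidParam hℓ hn, image_image]
    ext x
    simp [F]

/-! ### Partial derivatives -/

theorem pderiv_zero_eq {F : Type*} [NormedAddCommGroup F] [NormedSpace ℝ F] {f : ℝ × ℝ → F}
    {p : ℝ × ℝ} {d : F} (hf : DifferentiableAt ℝ f p)
    (h : HasDerivAt (fun t => f (t, p.2)) d p.1) : pderiv 0 f p = d := by
  have hc : HasDerivAt (fun t : ℝ => (t, p.2)) ((1 : ℝ), (0 : ℝ)) p.1 :=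
    (hasDerivAt_id p.1).prodMk (hasDerivAt_const _ _)
  exact (HasFDerivAt.comp_hasDerivAt p.1 (f := fun t : ℝ => (t, p.2)) hf.hasFDerivAt hc).unique h

theorem pderiv_one_eq {F : Type*} [NormedAddCommGroup F] [NormedSpace ℝ F] {f : ℝ × ℝ → F}
    {p : ℝ × ℝ} {d : F} (hf : DifferentiableAt ℝ f p)
    (h : HasDerivAt (fun v => f (p.1, v)) d p.2) : pderiv 1 f p = d := by
  have hc : HasDerivAt (fun v : ℝ => (p.1, v)) ((0 : ℝ), (1 : ℝ)) p.2 :=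
    (hasDerivAt_const _ _).prodMk (hasDerivAt_id p.2)
  exact (HasFDerivAt.comp_hasDerivAt p.2 (f := fun v : ℝ => (p.1, v)) hf.hasFDerivAt hc).unique h

/-- Coordinate projections are continuous linear, so they commute with differentiation. -/
theorem pderiv_vec {f g h : ℝ × ℝ → ℝ} (i : Fin 2) {p : ℝ × ℝ} {a b c : ℝ}
    (hf : DifferentiableAt ℝ f p) (hg : DifferentiableAt ℝ g p) (hh : DifferentiableAt ℝ h p)
    (ha : pderiv i f p = a) (hb : pderiv i g p = b) (hc : pderiv i h p = c) :
    pderiv i (fun q => (!₂[f q, g q, h q] : E3)) p = !₂[a, b, c] := by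
  have hd : DifferentiableAt ℝ (fun q => (!₂[f q, g q, h q] : E3)) p := by
    rw [differentiableAt_euclidean]
    intro k
    fin_cases k
    · exact hf
    · exact hg
    · exact hh
  have hk : ∀ k : Fin 3, (pderiv i (fun q => (!₂[f q, g q, h q] : E3)) p) k
      = pderiv i (fun q => (!₂[f q, g q, h q] : E3) k) p := fun k => by
    have := ((EuclideanSpace.proj (𝕜 := ℝ) k).hasFDerivAt.comp p hd.hasFDerivAt).fderiv
    exact (congrArg (fun L => L (coordDir i)) this).symm
  ext k
  rw [hk]
  fin_cases k
  · exact ha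
  · exact hb
  · exact hc

/-! ### The geometry of the helicoid -/

variable (ℓ : ℝ) (n : ℕ) (p : ℝ × ℝ)

theorem pderiv_zero_helicoidParam : pderiv 0 (helicoidParam ℓ n) p
    = !₂[-(n * Real.pi * p.2 * Real.sin (n * Real.pi * p.1)),
      n * Real.pi * p.2 * Real.cos (n * Real.pi * p.1), ℓ * Real.pi] := by
  have hl : HasDerivAt (fun t : ℝ => n * Real.pi * t) (n * Real.pi) p.1 := by
    simpa using (hasDerivAt_id p.1).const_mul (n * Real.pi)
  unfold helicoidParam
  refine pderiv_vec 0 (by fun_prop) (by fun_prop) (by fun_prop) ?_ ?_ ?_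
  · exact pderiv_zero_eq (by fun_prop) ((hl.cos.const_mul p.2).congr_deriv (by ring))
  · exact pderiv_zero_eq (by fun_prop) ((hl.sin.const_mul p.2).congr_deriv (by ring))
  · exact pderiv_zero_eq (by fun_prop)
      (((hasDerivAt_id p.1).const_mul (ℓ * Real.pi)).congr_deriv (by simp))

theorem pderiv_one_helicoidParam : pderiv 1 (helicoidParam ℓ n) p
    = !₂[Real.cos (n * Real.pi * p.1), Real.sin (n * Real.pi * p.1), 0] := by
  unfold helicoidParam
  refine pderiv_vec 1 (by fun_prop) (by fun_prop) (by fun_prop) ?_ ?_ ?_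
  · exact pderiv_one_eq (by fun_prop)
      (((hasDerivAt_id p.2).mul_const (Real.cos (n * Real.pi * p.1))).congr_deriv (by simp))
  · exact pderiv_one_eq (by fun_prop)
      (((hasDerivAt_id p.2).mul_const (Real.sin (n * Real.pi * p.1))).congr_deriv (by simp))
  · exact pderiv_one_eq (by fun_prop) (hasDerivAt_const p.2 (ℓ * Real.pi * p.1))

theorem pderiv_zero_pderiv_zero_helicoidParam : pderiv 0 (pderiv 0 (helicoidParam ℓ n)) p
    = !₂[-((n * Real.pi) ^ 2 * p.2 * Real.cos (n * Real.pi * p.1)),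
      -((n * Real.pi) ^ 2 * p.2 * Real.sin (n * Real.pi * p.1)), 0] := by
  have hl : HasDerivAt (fun t : ℝ => n * Real.pi * t) (n * Real.pi) p.1 := by
    simpa using (hasDerivAt_id p.1).const_mul (n * Real.pi)
  rw [show pderiv 0 (helicoidParam ℓ n) = _ from funext (pderiv_zero_helicoidParam ℓ n)]
  refine pderiv_vec 0 (by fun_prop) (by fun_prop) (by fun_prop) ?_ ?_ ?_
  · exact pderiv_zero_eq (by fun_prop)
      (((hl.sin.const_mul (n * Real.pi * p.2)).fun_neg).congr_deriv (by ring))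
  · exact pderiv_zero_eq (by fun_prop)
      ((hl.cos.const_mul (n * Real.pi * p.2)).congr_deriv (by ring))
  · exact pderiv_zero_eq (by fun_prop) (hasDerivAt_const _ _)

theorem pderiv_zero_pderiv_one_helicoidParam : pderiv 0 (pderiv 1 (helicoidParam ℓ n)) p
    = !₂[-(n * Real.pi * Real.sin (n * Real.pi * p.1)),
      n * Real.pi * Real.cos (n * Real.pi * p.1), 0] := by
  have hl : HasDerivAt (fun t : ℝ => n * Real.pi * t) (n * Real.pi) p.1 := by
    simpa using (hasDerivAt_id p.1).const_mul (n * Real.pi)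
  rw [show pderiv 1 (helicoidParam ℓ n) = _ from funext (pderiv_one_helicoidParam ℓ n)]
  refine pderiv_vec 0 (by fun_prop) (by fun_prop) (by fun_prop) ?_ ?_ ?_
  · exact pderiv_zero_eq (by fun_prop) (hl.cos.congr_deriv (by ring))
  · exact pderiv_zero_eq (by fun_prop) (hl.sin.congr_deriv (by ring))
  · exact pderiv_zero_eq (by fun_prop) (hasDerivAt_const _ _)

theorem pderiv_one_pderiv_zero_helicoidParam : pderiv 1 (pderiv 0 (helicoidParam ℓ n)) p
    = !₂[-(n * Real.pi * Real.sin (n * Real.pi * p.1)),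
      n * Real.pi * Real.cos (n * Real.pi * p.1), 0] := by
  have hl : HasDerivAt (fun v : ℝ => n * Real.pi * v) (n * Real.pi) p.2 := by
    simpa using (hasDerivAt_id p.2).const_mul (n * Real.pi)
  rw [show pderiv 0 (helicoidParam ℓ n) = _ from funext (pderiv_zero_helicoidParam ℓ n)]
  refine pderiv_vec 1 (by fun_prop) (by fun_prop) (by fun_prop) ?_ ?_ ?_
  · exact pderiv_one_eq (by fun_prop) (hl.mul_const (Real.sin (n * Real.pi * p.1))).fun_neg
  · exact pderiv_one_eq (by fun_prop) (hl.mul_const (Real.cos (n * Real.pi * p.1)))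
  · exact pderiv_one_eq (by fun_prop) (hasDerivAt_const _ _)

theorem pderiv_one_pderiv_one_helicoidParam : pderiv 1 (pderiv 1 (helicoidParam ℓ n)) p = 0 := by
  rw [show pderiv 1 (helicoidParam ℓ n) = _ from funext (pderiv_one_helicoidParam ℓ n)]
  refine (pderiv_vec 1 (a := 0) (b := 0) (c := 0) (by fun_prop) (by fun_prop) (by fun_prop)
    ?_ ?_ ?_).trans ?_
  · exact pderiv_one_eq (by fun_prop) (hasDerivAt_const p.2 (Real.cos (n * Real.pi * p.1)))
  · exact pderiv_one_eq (by fun_prop) (hasDerivAt_const p.2 (Real.sin (n * Real.pi * p.1)))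
  · exact pderiv_one_eq (by fun_prop) (hasDerivAt_const _ _)
  · ext k
    fin_cases k <;> rfl

/-! ### Metric, normal and curvature of the helicoid. -/

theorem inner_vec (x y : E3) : inner ℝ x y = x 0 * y 0 + x 1 * y 1 + x 2 * y 2 := by
  simp [PiLp.inner_apply, Fin.sum_univ_three, mul_comm]

/-- The length of the horizontal coordinate tangent vector of the helicoid. -/
noncomputable def stretch (v : ℝ) : ℝ := Real.sqrt ((n * Real.pi * v) ^ 2 + (ℓ * Real.pi) ^ 2)

theorem stretch_sq (v : ℝ) :
    stretch ℓ n v ^ 2 = (n * Real.pi * v) ^ 2 + (ℓ * Real.pi) ^ 2 :=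
  Real.sq_sqrt (by positivity)

variable {ℓ}

theorem stretch_pos (hℓ : 0 < ℓ) (v : ℝ) : 0 < stretch ℓ n v := by
  have := Real.pi_pos
  exact Real.sqrt_pos.2 (by positivity)

theorem contDiff_stretch (hℓ : 0 < ℓ) : ContDiff ℝ ∞ (stretch ℓ n) := by
  have := Real.pi_pos
  exact ContDiff.sqrt (by fun_prop) fun v => by positivity

theorem hasDerivAt_stretch (hℓ : 0 < ℓ) (v : ℝ) :
    HasDerivAt (stretch ℓ n) ((n * Real.pi) ^ 2 * v / stretch ℓ n v) v := by
  have := Real.pi_pos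
  have h0 : HasDerivAt (fun v : ℝ => (n * Real.pi * v) ^ 2 + (ℓ * Real.pi) ^ 2)
      (2 * ((n * Real.pi) ^ 2 * v)) v := by
    have := ((((hasDerivAt_id v).const_mul (n * Real.pi)).fun_pow 2).add_const ((ℓ * Real.pi) ^ 2))
    exact this.congr_deriv (by simp; ring)
  refine (h0.sqrt (by positivity)).congr_deriv ?_
  rw [stretch, mul_div_mul_left _ _ two_ne_zero]

variable (ℓ)

theorem firstForm_helicoidParam : firstForm (helicoidParam ℓ n) p
    = !![stretch ℓ n p.2 ^ 2, 0; 0, 1] := by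
  have hcs := Real.sin_sq_add_cos_sq (n * Real.pi * p.1)
  ext i j
  fin_cases i <;> fin_cases j <;>
    simp [firstForm, pderiv_zero_helicoidParam, pderiv_one_helicoidParam, stretch_sq, inner_vec]
  · linear_combination (n * Real.pi * p.2) ^ 2 * hcs
  · ring
  · ring
  · linear_combination hcs

theorem normalVector_helicoidParam : normalVector (helicoidParam ℓ n) p
    = !₂[-(ℓ * Real.pi * Real.sin (n * Real.pi * p.1)),
      ℓ * Real.pi * Real.cos (n * Real.pi * p.1), -(n * Real.pi * p.2)] := by
  have hcs := Real.sin_sq_add_cos_sq (n * Real.pi * p.1)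
  rw [normalVector, pderiv_zero_helicoidParam, pderiv_one_helicoidParam, cross_apply]
  ext k
  fin_cases k <;> simp
  linear_combination -(n * Real.pi * p.2) * hcs

theorem norm_vec (x : E3) : ‖x‖ = Real.sqrt (x 0 ^ 2 + x 1 ^ 2 + x 2 ^ 2) := by
  simp [EuclideanSpace.norm_eq, Fin.sum_univ_three]

theorem norm_normalVector_helicoidParam :
    ‖normalVector (helicoidParam ℓ n) p‖ = stretch ℓ n p.2 := by
  have hcs := Real.sin_sq_add_cos_sq (n * Real.pi * p.1)
  rw [normalVector_helicoidParam, norm_vec, stretch]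
  congr 1
  simp
  linear_combination (ℓ * Real.pi) ^ 2 * hcs

theorem norm_pderiv_zero_helicoidParam :
    ‖pderiv 0 (helicoidParam ℓ n) p‖ = stretch ℓ n p.2 := by
  have hcs := Real.sin_sq_add_cos_sq (n * Real.pi * p.1)
  rw [pderiv_zero_helicoidParam, norm_vec, stretch]
  congr 1
  simp
  linear_combination (n * Real.pi * p.2) ^ 2 * hcs

theorem unitNormal_helicoidParam : unitNormal (helicoidParam ℓ n) p
    = (stretch ℓ n p.2)⁻¹ • !₂[-(ℓ * Real.pi * Real.sin (n * Real.pi * p.1)),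
      ℓ * Real.pi * Real.cos (n * Real.pi * p.1), -(n * Real.pi * p.2)] := by
  rw [unitNormal, norm_normalVector_helicoidParam, normalVector_helicoidParam]

theorem secondForm_helicoidParam : secondForm (helicoidParam ℓ n) p
    = (n * Real.pi * (ℓ * Real.pi) * (stretch ℓ n p.2)⁻¹) • !![0, 1; 1, 0] := by
  have hcs := Real.sin_sq_add_cos_sq (n * Real.pi * p.1)
  ext i j
  fin_cases i <;> fin_cases j <;>
    simp [secondForm, unitNormal_helicoidParam, inner_smul_right, inner_vec,
      pderiv_zero_pderiv_zero_helicoidParam, pderiv_zero_pderiv_one_helicoidParam,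
      pderiv_one_pderiv_zero_helicoidParam, pderiv_one_pderiv_one_helicoidParam]
  · right; ring
  · linear_combination n * Real.pi * (ℓ * Real.pi) * (stretch ℓ n p.2)⁻¹ * hcs
  · linear_combination n * Real.pi * (ℓ * Real.pi) * (stretch ℓ n p.2)⁻¹ * hcs

variable {ℓ}

theorem areaDensity_helicoidParam : areaDensity (helicoidParam ℓ n) p = stretch ℓ n p.2 := by
  rw [areaDensity, firstForm_helicoidParam, Matrix.det_fin_two_of]
  simp [stretch]

theorem inv_firstForm_helicoidParam (hℓ : 0 < ℓ) : (firstForm (helicoidParam ℓ n) p)⁻¹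
    = !![(stretch ℓ n p.2 ^ 2)⁻¹, 0; 0, 1] := by
  have := (stretch_pos n hℓ p.2).ne'
  refine Matrix.inv_eq_right_inv ?_
  rw [firstForm_helicoidParam, Matrix.mul_fin_two, Matrix.one_fin_two]
  simp [this]

/-- The metric is diagonal and the second fundamental form is off-diagonal, so the trace vanishes.
-/
theorem meanCurvature_helicoidParam (hℓ : 0 < ℓ) : meanCurvature (helicoidParam ℓ n) p = 0 := by
  rw [meanCurvature, inv_firstForm_helicoidParam n p hℓ, secondForm_helicoidParam,
    Matrix.mul_smul, Matrix.mul_fin_two, Matrix.trace_smul, Matrix.trace_fin_two_of]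
  simp

theorem secondFormNormSq_helicoidParam (hℓ : 0 < ℓ) : secondFormNormSq (helicoidParam ℓ n) p
    = 2 * (n * Real.pi) ^ 2 * (ℓ * Real.pi) ^ 2 * ((stretch ℓ n p.2)⁻¹) ^ 4 := by
  rw [secondFormNormSq, inv_firstForm_helicoidParam n p hℓ, secondForm_helicoidParam,
    Matrix.mul_smul, Matrix.mul_fin_two, Matrix.smul_mul, Matrix.mul_smul, Matrix.mul_fin_two,
    Matrix.trace_smul, Matrix.trace_smul, Matrix.trace_fin_two_of]
  simp
  ring

theorem gradNormSq_helicoidParam (hℓ : 0 < ℓ) (f : ℝ × ℝ → ℝ) :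
    gradNormSq (helicoidParam ℓ n) f p
      = ((stretch ℓ n p.2)⁻¹) ^ 2 * pderiv 0 f p ^ 2 + pderiv 1 f p ^ 2 := by
  rw [gradNormSq, inv_firstForm_helicoidParam n p hℓ]
  simp [Fin.sum_univ_two]
  ring

theorem fderiv_outwardNormal (x y : E3) : fderiv ℝ outwardNormal x y = outwardNormal y := by
  let L : E3 →ₗ[ℝ] E3 :=
    { toFun := outwardNormal
      map_add' := fun x y => by ext k; fin_cases k <;> simp [outwardNormal]
      map_smul' := fun c x => by ext k; fin_cases k <;> simp [outwardNormal] }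
  have h : outwardNormal = LinearMap.toContinuousLinearMap L := rfl
  rw [h, ContinuousLinearMap.fderiv]

theorem boundaryForm_helicoidParam : boundaryForm (helicoidParam ℓ n) p
    = (ℓ * Real.pi) ^ 2 * ((stretch ℓ n p.2)⁻¹) ^ 2 := by
  have hcs := Real.sin_sq_add_cos_sq (n * Real.pi * p.1)
  rw [boundaryForm, fderiv_outwardNormal, unitNormal_helicoidParam, inner_vec]
  simp [outwardNormal]
  linear_combination (ℓ * Real.pi) ^ 2 * ((stretch ℓ n p.2)⁻¹) ^ 2 * hcs

/-- Along the helicoid the radial field is `v` times the ruling direction, hence tangent at every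
point and not only on the boundary. -/
theorem inner_unitNormal_outwardNormal :
    inner ℝ (unitNormal (helicoidParam ℓ n) p) (outwardNormal (helicoidParam ℓ n p)) = 0 := by
  rw [unitNormal_helicoidParam, inner_vec]
  simp [outwardNormal, helicoidParam]
  ring

theorem injective_fderiv_helicoidParam (hℓ : 0 < ℓ) :
    Function.Injective (fderiv ℝ (helicoidParam ℓ n) p) := by
  have hpi := Real.pi_pos
  rw [injective_iff_map_eq_zero]
  intro x hx
  have e : x = x.1 • coordDir 0 + x.2 • coordDir 1 := by
    ext <;> simp [coordDir]
  have hx' : x.1 • pderiv 0 (helicoidParam ℓ n) p + x.2 • pderiv 1 (helicoidParam ℓ n) p = 0 := by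
    rw [e, map_add, map_smul, map_smul] at hx
    exact hx
  rw [pderiv_zero_helicoidParam, pderiv_one_helicoidParam] at hx'
  have h2 := congrArg (fun y : E3 => y 2) hx'
  have h1 : x.1 = 0 := by
    simpa [hℓ.ne', hpi.ne'] using h2
  have h0 := congrArg (fun y : E3 => y 0) hx'
  have h1' := congrArg (fun y : E3 => y 1) hx'
  simp [h1] at h0 h1'
  have hcs := Real.sin_sq_add_cos_sq (n * Real.pi * p.1)
  refine Prod.ext h1 ?_
  rcases h0 with h0 | h0
  · exact h0
  · rcases h1' with h1' | h1'
    · exact h1'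
    · simp [h0, h1'] at hcs

end HelicoidIndex

namespace HelicoidIndex

/-! ### Trigonometric modes -/

/-- The trigonometric mode `cos (m π t) + sin (m π t)`. -/
noncomputable def mode (m : ℤ) (t : ℝ) : ℝ :=
  Real.cos (m * Real.pi * t) + Real.sin (m * Real.pi * t)

theorem contDiff_mode (m : ℤ) : ContDiff ℝ ∞ (mode m) := by
  unfold mode
  fun_prop

/-- Differentiation stays within the family of modes, so Parseval's identity also computes the
Dirichlet energy. -/
theorem hasDerivAt_mode (m : ℤ) (t : ℝ) : HasDerivAt (mode m) (m * Real.pi * mode (-m) t) t := by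
  have hl : HasDerivAt (fun t : ℝ => m * Real.pi * t) (m * Real.pi) t := by
    simpa using (hasDerivAt_id t).const_mul (m * Real.pi)
  refine (hl.cos.fun_add hl.sin).congr_deriv ?_
  simp only [mode, Int.cast_neg, neg_mul, Real.cos_neg, Real.sin_neg]
  ring

theorem mode_add_one (m : ℤ) (t : ℝ) :
    mode m (t + 1) = (((-1 : ℤˣ) ^ m : ℤˣ) : ℤ) * mode m t := by
  rw [mode, mode, mul_add, mul_one, cos_add_zmul_pi, sin_add_zmul_pi]
  ring

theorem mode_mul_mode (m l : ℤ) (t : ℝ) : mode m t * mode l t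
    = Real.cos (((m - l : ℤ) : ℝ) * Real.pi * t) + Real.sin (((m + l : ℤ) : ℝ) * Real.pi * t) := by
  have h1 : ((m - l : ℤ) : ℝ) * Real.pi * t = m * Real.pi * t - l * Real.pi * t := by
    push_cast; ring
  have h2 : ((m + l : ℤ) : ℝ) * Real.pi * t = m * Real.pi * t + l * Real.pi * t := by
    push_cast; ring
  rw [h1, h2, Real.cos_sub, Real.sin_add, mode, mode]
  ring

theorem integral_cos_int_mul_pi (k : ℤ) :
    ∫ t in (0 : ℝ)..1, Real.cos (k * Real.pi * t) = if k = 0 then 1 else 0 := by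
  split_ifs with h
  · simp [h]
  · have hk : (k * Real.pi : ℝ) ≠ 0 := by
      have : (k : ℝ) ≠ 0 := by exact_mod_cast h
      have := Real.pi_ne_zero
      positivity
    rw [intervalIntegral.integral_comp_mul_left Real.cos hk, integral_cos]
    simp [Real.sin_int_mul_pi]

/-- On `[0, 1]` an even `k` gives whole periods; for odd `k` the integral is nonzero. This is why
modes of equal parity are needed for orthogonality. -/
theorem integral_sin_int_mul_pi {k : ℤ} (hk : Even k) :
    ∫ t in (0 : ℝ)..1, Real.sin (k * Real.pi * t) = 0 := by
  rcases eq_or_ne k 0 with h | h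
  · simp [h]
  · have hk' : (k * Real.pi : ℝ) ≠ 0 := by
      have : (k : ℝ) ≠ 0 := by exact_mod_cast h
      have := Real.pi_ne_zero
      positivity
    rw [intervalIntegral.integral_comp_mul_left Real.sin hk', integral_sin]
    simp [Real.cos_int_mul_pi, hk.neg_one_zpow]

theorem integral_mode_mul_mode {m l : ℤ} (h : Even (m + l)) :
    ∫ t in (0 : ℝ)..1, mode m t * mode l t = if m = l then 1 else 0 := by
  simp only [mode_mul_mode]
  rw [intervalIntegral.integral_add (Continuous.intervalIntegrable (by fun_prop) _ _)
    (Continuous.intervalIntegrable (by fun_prop) _ _), integral_cos_int_mul_pi,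
    integral_sin_int_mul_pi h, add_zero]
  simp only [sub_eq_zero]

/-- Parseval's identity for modes of the same parity. -/
theorem integral_sum_mode_sq {ι : Type*} [Fintype ι] {m : ι → ℤ} (hm : Function.Injective m)
    (hpar : ∀ i j, Even (m i + m j)) (c : ι → ℝ) :
    ∫ t in (0 : ℝ)..1, (∑ i, c i * mode (m i) t) ^ 2 = ∑ i, c i ^ 2 := by
  classical
  have hc : ∀ k, Continuous (mode k) := fun k => (contDiff_mode k).continuous
  have e : ∀ t, (∑ i, c i * mode (m i) t) ^ 2
      = ∑ i, ∑ j, c i * c j * (mode (m i) t * mode (m j) t) := fun t => by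
    rw [sq, Finset.sum_mul_sum]
    exact Finset.sum_congr rfl fun i _ => Finset.sum_congr rfl fun j _ => by ring
  simp only [e]
  rw [intervalIntegral.integral_finsetSum fun i _ =>
    Continuous.intervalIntegrable (by fun_prop) _ _]
  refine Finset.sum_congr rfl fun i _ => ?_
  rw [intervalIntegral.integral_finsetSum fun j _ =>
    Continuous.intervalIntegrable (by fun_prop) _ _]
  simp [integral_mode_mul_mode (hpar _ _), hm.eq_iff, sq]

/-! ### The index form on test sections -/

variable {ℓ : ℝ} (n : ℕ)

theorem hasDerivAt_inv_stretch (hℓ : 0 < ℓ) (v : ℝ) :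
    HasDerivAt (fun v => (stretch ℓ n v)⁻¹)
      (-((n * Real.pi) ^ 2 * v * ((stretch ℓ n v)⁻¹) ^ 3)) v := by
  have h := (stretch_pos n hℓ v).ne'
  refine ((hasDerivAt_stretch n hℓ v).fun_inv h).congr_deriv ?_
  field_simp

theorem contDiff_inv_stretch (hℓ : 0 < ℓ) : ContDiff ℝ ∞ fun v => (stretch ℓ n v)⁻¹ :=
  (contDiff_stretch n hℓ).inv fun v => (stretch_pos n hℓ v).ne'

/-- Integrated form of the Jacobi equation for horizontal translations. The integrand is the
derivative of `w⁻¹ · w · (w⁻¹)'`, where `w = stretch`, so only boundary values remain. -/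
theorem integral_jacobi (hℓ : 0 < ℓ) :
    ∫ v in (-1 : ℝ)..1, ((n * Real.pi) ^ 2 * ((stretch ℓ n v)⁻¹) ^ 3
      + ((n * Real.pi) ^ 4 * v ^ 2 - 2 * (n * Real.pi) ^ 2 * (ℓ * Real.pi) ^ 2)
        * ((stretch ℓ n v)⁻¹) ^ 5)
      = -(2 * (n * Real.pi) ^ 2 * ((stretch ℓ n 1)⁻¹) ^ 3) := by
  have hcont := (contDiff_inv_stretch n hℓ).continuous
  have hd : ∀ v : ℝ, HasDerivAt
      (fun v => -((n * Real.pi) ^ 2 * v * ((stretch ℓ n v)⁻¹) ^ 3))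
      ((n * Real.pi) ^ 2 * ((stretch ℓ n v)⁻¹) ^ 3
      + ((n * Real.pi) ^ 4 * v ^ 2 - 2 * (n * Real.pi) ^ 2 * (ℓ * Real.pi) ^ 2)
        * ((stretch ℓ n v)⁻¹) ^ 5) v := fun v => by
    refine ((((hasDerivAt_id' v).const_mul ((n * Real.pi) ^ 2)).fun_mul
      ((hasDerivAt_inv_stretch n hℓ v).fun_pow 3)).fun_neg).congr_deriv ?_
    have hu : (stretch ℓ n v)⁻¹ ^ 2 * ((n * Real.pi * v) ^ 2 + (ℓ * Real.pi) ^ 2) = 1 := by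
      rw [← stretch_sq, ← mul_pow, inv_mul_cancel₀ (stretch_pos n hℓ v).ne', one_pow]
    push_cast
    linear_combination 2 * (n * Real.pi) ^ 2 * (stretch ℓ n v)⁻¹ ^ 3 * hu
  rw [intervalIntegral.integral_eq_sub_of_hasDerivAt (fun v _ => hd v)
    (Continuous.intervalIntegrable (by fun_prop) _ _)]
  have : stretch ℓ n (-1) = stretch ℓ n 1 := by simp [stretch]
  rw [this]
  ring

/-- The metric coefficients depend on `v` alone, so each term of the form is a product of an
integral in `t` and a factor in `v`. The two boundary circles contribute equally because `stretch`
is even. -/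
theorem indexForm_mul_inv_stretch (hℓ : 0 < ℓ) {T T' : ℝ → ℝ} (hT : ∀ t, HasDerivAt T (T' t) t)
    (hT' : Continuous T') :
    indexForm (helicoidParam ℓ n) (fun p => T p.1 * (stretch ℓ n p.2)⁻¹)
      = (∫ t in (0 : ℝ)..1, T' t ^ 2) * (∫ v in (-1 : ℝ)..1, ((stretch ℓ n v)⁻¹) ^ 3)
        + (∫ t in (0 : ℝ)..1, T t ^ 2) * (∫ v in (-1 : ℝ)..1,
          ((n * Real.pi) ^ 4 * v ^ 2 - 2 * (n * Real.pi) ^ 2 * (ℓ * Real.pi) ^ 2)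
            * ((stretch ℓ n v)⁻¹) ^ 5)
        - 2 * (ℓ * Real.pi) ^ 2 * ((stretch ℓ n 1)⁻¹) ^ 3 * ∫ t in (0 : ℝ)..1, T t ^ 2 := by
  have hTc : Continuous T := continuous_iff_continuousAt.2 fun t => (hT t).continuousAt
  have hu := (contDiff_inv_stretch n hℓ).continuous
  have hu₂ : Continuous fun p : ℝ × ℝ => (stretch ℓ n p.2)⁻¹ := hu.comp continuous_snd
  have hdiff : ∀ p : ℝ × ℝ, DifferentiableAt ℝ (fun p : ℝ × ℝ => T p.1 * (stretch ℓ n p.2)⁻¹) p :=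
    fun p => ((hT p.1).differentiableAt.comp p differentiableAt_fst).fun_mul
      ((hasDerivAt_inv_stretch n hℓ p.2).differentiableAt.comp p differentiableAt_snd)
  have e0 : ∀ p, pderiv 0 (fun p : ℝ × ℝ => T p.1 * (stretch ℓ n p.2)⁻¹) p
      = T' p.1 * (stretch ℓ n p.2)⁻¹ := fun p =>
    pderiv_zero_eq (hdiff p) ((hT p.1).mul_const (stretch ℓ n p.2)⁻¹)
  have e1 : ∀ p, pderiv 1 (fun p : ℝ × ℝ => T p.1 * (stretch ℓ n p.2)⁻¹) p
      = T p.1 * (-((n * Real.pi) ^ 2 * p.2 * ((stretch ℓ n p.2)⁻¹) ^ 3)) := fun p =>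
    pderiv_one_eq (hdiff p) ((hasDerivAt_inv_stretch n hℓ p.2).const_mul (T p.1))
  have hint : ∀ p : ℝ × ℝ,
      (gradNormSq (helicoidParam ℓ n) (fun p => T p.1 * (stretch ℓ n p.2)⁻¹) p
        - secondFormNormSq (helicoidParam ℓ n) p * (T p.1 * (stretch ℓ n p.2)⁻¹) ^ 2)
        * areaDensity (helicoidParam ℓ n) p
      = T' p.1 ^ 2 * ((stretch ℓ n p.2)⁻¹) ^ 3 + T p.1 ^ 2 * (((n * Real.pi) ^ 4 * p.2 ^ 2
        - 2 * (n * Real.pi) ^ 2 * (ℓ * Real.pi) ^ 2) * ((stretch ℓ n p.2)⁻¹) ^ 5) := fun p => by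
    have h := (stretch_pos n hℓ p.2).ne'
    rw [gradNormSq_helicoidParam n p hℓ, secondFormNormSq_helicoidParam n p hℓ,
      areaDensity_helicoidParam, e0, e1]
    field_simp
    ring
  have hbd : ∀ (t s : ℝ), s = 1 ∨ s = -1 → boundaryForm (helicoidParam ℓ n) (t, s)
      * (T t * (stretch ℓ n s)⁻¹) ^ 2 * ‖pderiv 0 (helicoidParam ℓ n) (t, s)‖
      = (ℓ * Real.pi) ^ 2 * ((stretch ℓ n 1)⁻¹) ^ 3 * T t ^ 2 := fun t s hs => by
    have h := (stretch_pos n hℓ 1).ne'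
    have hs' : stretch ℓ n s = stretch ℓ n 1 := by rcases hs with rfl | rfl <;> simp [stretch]
    rw [boundaryForm_helicoidParam, norm_pderiv_zero_helicoidParam]
    simp only [hs']
    field_simp
  have hI : ∀ f : ℝ × ℝ → ℝ, Continuous f → IntegrableOn f fundamentalDomain := fun f hf =>
    hf.continuousOn.integrableOn_compact (isCompact_Icc.prod isCompact_Icc)
  have hprod : ∀ f g : ℝ → ℝ, ∫ p in fundamentalDomain, f p.1 * g p.2
      = (∫ t in (0 : ℝ)..1, f t) * ∫ v in (-1 : ℝ)..1, g v := fun f g => by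
    rw [fundamentalDomain, Measure.volume_eq_prod, setIntegral_prod_mul,
      integral_Icc_eq_integral_Ioc, integral_Icc_eq_integral_Ioc,
      intervalIntegral.integral_of_le zero_le_one, intervalIntegral.integral_of_le (by norm_num)]
  rw [indexForm]
  simp only [hint, hbd _ _ (Or.inl rfl), hbd _ _ (Or.inr rfl),
    intervalIntegral.integral_const_mul]
  rw [integral_add (hI _ (by fun_prop)) (hI _ (by fun_prop)),
    hprod (fun t => T' t ^ 2) (fun v => ((stretch ℓ n v)⁻¹) ^ 3),
    hprod (fun t => T t ^ 2) (fun v => ((n * Real.pi) ^ 4 * v ^ 2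
        - 2 * (n * Real.pi) ^ 2 * (ℓ * Real.pi) ^ 2) * ((stretch ℓ n v)⁻¹) ^ 5)]
  ring

theorem indexForm_neg_of_integral_sq_le (hℓ : 0 < ℓ) {T T' : ℝ → ℝ}
    (hT : ∀ t, HasDerivAt T (T' t) t) (hT' : Continuous T')
    (hpos : 0 < ∫ t in (0 : ℝ)..1, T t ^ 2)
    (hle : ∫ t in (0 : ℝ)..1, T' t ^ 2 ≤ (n * Real.pi) ^ 2 * ∫ t in (0 : ℝ)..1, T t ^ 2) :
    indexForm (helicoidParam ℓ n) (fun p => T p.1 * (stretch ℓ n p.2)⁻¹) < 0 := by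
  have hu := (contDiff_inv_stretch n hℓ).continuous
  have hw := stretch_pos n hℓ 1
  have hpi := Real.pi_pos
  have hα : 0 ≤ ∫ v in (-1 : ℝ)..1, ((stretch ℓ n v)⁻¹) ^ 3 :=
    intervalIntegral.integral_nonneg (by norm_num) fun v _ => by
      have := stretch_pos n hℓ v
      positivity
  have hJ := integral_jacobi n hℓ
  rw [intervalIntegral.integral_add (Continuous.intervalIntegrable (by fun_prop) _ _)
    (Continuous.intervalIntegrable (by fun_prop) _ _),
    intervalIntegral.integral_const_mul] at hJ
  rw [indexForm_mul_inv_stretch n hℓ hT hT']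
  have hmul := mul_le_mul_of_nonneg_right hle hα
  -- The amount by which the form is negative: `(n π)²` comes from the boundary term of
  -- `integral_jacobi`, and `(ℓ π)²` from the curvature of the cylinder.
  have hβ : 0 < (∫ t in (0 : ℝ)..1, T t ^ 2) *
      (2 * ((n * Real.pi) ^ 2 + (ℓ * Real.pi) ^ 2) * ((stretch ℓ n 1)⁻¹) ^ 3) := by positivity
  have hJ' := congrArg (fun x => (∫ t in (0 : ℝ)..1, T t ^ 2) * x) hJ
  linarith

/-! ### The space of destabilising sections -/

/-- The frequency `n - 2 j`. -/
def frequency (j : Fin (n + 1)) : ℤ := n - 2 * (j : ℕ)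

theorem frequency_injective : Function.Injective (frequency n) := fun i j h => by
  simp only [frequency] at h
  exact Fin.ext (by omega)

theorem even_frequency_add (i j : Fin (n + 1)) : Even (frequency n i + frequency n j) :=
  ⟨n - (i : ℕ) - (j : ℕ), by simp only [frequency]; ring⟩

theorem frequency_sq_le (j : Fin (n + 1)) : (frequency n j : ℝ) ^ 2 ≤ n ^ 2 := by
  have h : (frequency n j) ^ 2 ≤ (n : ℤ) ^ 2 := by
    rw [sq_le_sq, Nat.abs_cast, abs_le]
    have := j.is_lt
    simp only [frequency]
    constructor <;> omega
  exact_mod_cast h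

theorem negOne_zpow_frequency (j : Fin (n + 1)) : (-1 : ℤˣ) ^ frequency n j = (-1) ^ n := by
  rw [frequency, zpow_sub, zpow_mul, zpow_natCast]
  simp

variable (ℓ)

/-- The normal sections `T(t) |∂ₜ|⁻¹`, where `T` is a combination of modes of frequency at
most `n` and of the same parity as `n`. -/
noncomputable def destabilising : (Fin (n + 1) → ℝ) →ₗ[ℝ] (ℝ × ℝ → ℝ) where
  toFun c p := (∑ j, c j * mode (frequency n j) p.1) * (stretch ℓ n p.2)⁻¹
  map_add' c d := by
    ext p
    simp only [Pi.add_apply, add_mul, Finset.sum_add_distrib]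
  map_smul' r c := by
    ext p
    simp only [Pi.smul_apply, smul_eq_mul, mul_assoc, ← Finset.mul_sum, RingHom.id_apply]

variable {ℓ}

theorem indexForm_destabilising_neg (hℓ : 0 < ℓ) {c : Fin (n + 1) → ℝ} (hc : c ≠ 0) :
    indexForm (helicoidParam ℓ n) (destabilising ℓ n c) < 0 := by
  have hmode : ∀ k, Continuous (mode k) := fun k => (contDiff_mode k).continuous
  have hS := integral_sum_mode_sq (frequency_injective n) (even_frequency_add n) c
  -- Parseval for `T'`, whose modes carry the negated frequencies.
  have hS' := integral_sum_mode_sq (m := fun j => -frequency n j)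
    (neg_injective.comp (frequency_injective n))
    (fun i j => by rw [← neg_add]; exact (even_frequency_add n i j).neg)
    (fun j => c j * (frequency n j * Real.pi))
  refine indexForm_neg_of_integral_sq_le n hℓ
    (T := fun t => ∑ j, c j * mode (frequency n j) t)
    (T' := fun t => ∑ j, c j * (frequency n j * Real.pi) * mode (-frequency n j) t)
    (fun t => ?_) (by fun_prop) ?_ ?_
  · refine HasDerivAt.fun_sum fun j _ => ?_
    exact ((hasDerivAt_mode (frequency n j) t).const_mul (c j)).congr_deriv (by ring)
  · rw [hS]
    obtain ⟨j, hj⟩ := Function.ne_iff.1 hc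
    exact Finset.sum_pos' (fun i _ => sq_nonneg _) ⟨j, Finset.mem_univ j, by
      simp only [Pi.zero_apply] at hj
      positivity⟩
  · rw [hS, hS', Finset.mul_sum]
    refine Finset.sum_le_sum fun j _ => ?_
    have h := mul_le_mul_of_nonneg_right (frequency_sq_le n j) (sq_nonneg (c j * Real.pi))
    nlinarith [h]

theorem indexForm_zero (φ : ℝ × ℝ → E3) : indexForm φ 0 = 0 := by
  have h : ∀ i p, pderiv i (0 : ℝ × ℝ → ℝ) p = 0 := fun i p => by simp [pderiv]
  simp [indexForm, gradNormSq, h]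

/-- Independence comes for free from negativity: a nonzero coefficient vector in the kernel would
give the zero section a negative index form. -/
theorem destabilising_injective (hℓ : 0 < ℓ) : Function.Injective (destabilising ℓ n) := by
  rw [injective_iff_map_eq_zero]
  intro c hc
  by_contra h
  have := indexForm_destabilising_neg n hℓ h
  rw [hc, indexForm_zero] at this
  exact lt_irrefl _ this

theorem stretch_unit_mul (u : ℤˣ) (v : ℝ) : stretch ℓ n (((u : ℤ) : ℝ) * v) = stretch ℓ n v := by
  rw [stretch, stretch]
  congr 2
  linear_combination (n * Real.pi * v) ^ 2 * unit_cast_mul_self u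

/-- For odd `n` the normal changes sign around the band, reflecting one-sidedness; the coefficient
of a normal section must then change sign as well. -/
theorem unitNormal_deck (p : ℝ × ℝ) : unitNormal (helicoidParam ℓ n) (deck ((-1) ^ n) 1 p)
    = ((((-1 : ℤˣ) ^ n : ℤˣ) : ℤ) : ℝ) • unitNormal (helicoidParam ℓ n) p := by
  have e : (n : ℝ) * Real.pi * (p.1 + 1) = n * Real.pi * p.1 + ((n : ℤ) : ℝ) * Real.pi := by
    push_cast
    ring
  simp only [unitNormal_helicoidParam, deck, zpow_one, stretch_unit_mul, Int.cast_one, e, cos_add_zmul_pi,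
    sin_add_zmul_pi, zpow_natCast]
  ext k
  fin_cases k <;> simp <;> ring

theorem destabilising_mem_normalSections (hℓ : 0 < ℓ) (c : Fin (n + 1) → ℝ) :
    destabilising ℓ n c ∈ normalSections ((-1) ^ n) (helicoidParam ℓ n) := by
  refine ⟨?_, fun p _ => ?_⟩
  · refine ContDiff.mul (ContDiff.sum fun j _ => contDiff_const.mul ?_) ?_
    · exact (contDiff_mode _).comp contDiff_fst
    · exact (contDiff_inv_stretch n hℓ).comp contDiff_snd
  · have hu := unit_cast_mul_self ((-1 : ℤˣ) ^ n)
    have h : destabilising ℓ n c (deck ((-1) ^ n) 1 p)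
        = ((((-1 : ℤˣ) ^ n : ℤˣ) : ℤ) : ℝ) * destabilising ℓ n c p := by
      change (∑ j, c j * mode (frequency n j) (deck ((-1) ^ n) 1 p).1)
        * (stretch ℓ n (deck ((-1) ^ n) 1 p).2)⁻¹ = _ * ((∑ j, c j * mode (frequency n j) p.1)
          * (stretch ℓ n p.2)⁻¹)
      simp only [deck, zpow_one, Int.cast_one, stretch_unit_mul, mode_add_one, negOne_zpow_frequency]
      rw [← mul_assoc, Finset.mul_sum]
      congr 1
      exact Finset.sum_congr rfl fun j _ => by ring
    rw [unitNormal_deck, h, smul_smul]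
    congr 1
    linear_combination destabilising ℓ n c p * hu

theorem succ_le_morseIndex_helicoidParam (hℓ : 0 < ℓ) :
    ((n + 1 : ℕ) : ℕ∞) ≤ morseIndex ((-1) ^ n) (helicoidParam ℓ n) := by
  refine le_sSup ⟨LinearMap.range (destabilising ℓ n), ?_, inferInstance, ?_, ?_⟩
  · rintro _ ⟨c, rfl⟩
    exact destabilising_mem_normalSections n hℓ c
  · rw [LinearMap.finrank_range_of_inj (destabilising_injective n hℓ)]
    simp
  · rintro _ ⟨c, rfl⟩ hne
    exact indexForm_destabilising_neg n hℓ fun h => hne (by rw [h, map_zero])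

/-! ### Assembly of the final statement. -/

theorem isFreeBoundaryMinimalBand_helicoidQuotient {n : ℕ} (hℓ : 0 < ℓ) (hn : 1 ≤ n) :
    IsFreeBoundaryMinimalBand ℓ ((-1) ^ n) (helicoidParam ℓ n) (helicoidQuotient ℓ n) where
  smooth := contDiff_helicoidParam ℓ n
  immersion p _ := injective_fderiv_helicoidParam n p hℓ
  embedding := exists_embedding_helicoidQuotient hℓ hn
  mem_cylinder p hp := by
    rw [solidCylinder, mem_ofPred_eq, helicoidParam_sq_add_sq]
    exact sq_le_one_of_mem_strip hp
  proper p _ := by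
    rw [cylinderBoundary, mem_ofPred_eq, helicoidParam_sq_add_sq, ← sq_abs,
      pow_eq_one_iff_of_nonneg (abs_nonneg _) two_ne_zero]
  minimal p _ := meanCurvature_helicoidParam n p hℓ
  orthogonal p _ _ := inner_unitNormal_outwardNormal n p

end HelicoidIndex

open HelicoidIndex
theorem corollary2p3 (ℓ : ℝ) (hℓ : 0 < ℓ) (n : ℕ) (hn : 1 ≤ n) :
    helicoidQuotient ℓ n ⊆ solidTorus ℓ ∧
    proj ℓ ⁻¹' helicoidQuotient ℓ n = helicoidPiece ℓ n ∧
    IsDihedralEquivariant ℓ n (helicoidQuotient ℓ n) ∧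
    IsFreeBoundaryMinimalBand ℓ ((-1) ^ n) (helicoidParam ℓ n) (helicoidQuotient ℓ n) ∧
    (n : ℕ∞) ≤ morseIndex ((-1) ^ n) (helicoidParam ℓ n) :=
  ⟨image_mono inter_subset_left, preimage_helicoidQuotient hℓ hn,
    isDihedralEquivariant_helicoidQuotient hℓ hn,
    isFreeBoundaryMinimalBand_helicoidQuotient hℓ hn,
    le_trans (by exact_mod_cast n.le_succ) (succ_le_morseIndex_helicoidParam n hℓ)⟩
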